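/- An orthogonal polygon is a simple closed polygon in $\mathbb{R}^2$ (pairwise distinct vertices; two distinct sides meet at most in a common endpoint) whose sides are alternately horizontal and vertical; the rectilinear domain $D$ it bounds is the closed region consisting of the polygon and the points it encloses. Two points of $D$ have $r$-vision of each other if some non-degenerate axis-aligned rectangle contained in $D$ contains both. A point $r$-guard is a point $y\in D$ such that the maximal horizontal and the maximal vertical line segment in $D$ through $y$ contain no vertex of $D$. A vertical (horizontal) mobile $r$-guard is a vertical (horizontal) line segment in $D$ such that the maximal line segment in $D$ containing it contains no vertex of $D$; it covers the points of $D$ that are $r$-visible from at least one of its points. A system of guards of one of these three kinds is a set of such guards that together cover $D$. Let $p$, $m_V$ and $m_H$ be the minimum sizes of a point $r$-guard system, of a vertical mobile $r$-guard system and of a horizontal mobile $r$-guard system of $D$, respectively. (a) For every rectilinear domain $D$ (without holes): if $m_V=1$ or $m_H=1$, then $p\le m_V+m_H-1$. (b) Combs show that this is sharp. For every integer $k\ge 1$, the comb with $k$ teeth $$C_k=\bigl([0,2k]\times[0,1]\bigr)\cup\bigcup_{i=0}^{k-1}\bigl([2i+1,2i+2]\times[-5,0]\bigr)$$ is a rectilinear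 domain with $m_H=1$, $m_V=k$ and $p=k=m_V+m_H-1$; its mirror image in the line $x=y$ is a rectilinear domain with $m_V=1$, $m_H=k$ and $p=k=m_V+m_H-1$. -/

import Mathlib

/-- A (simple) orthogonal polygon: a cyclically ordered list of pairwise distinct vertices in the
plane. The `i`-th side joins `vertex i` to `vertex (i + 1)`; the sides are alternately horizontal
and vertical, and two distinct sides meet at most in a common endpoint. -/
structure OrthogonalPolygon where
  /-- the number of vertices -/
  n : ℕ
  four_le : 4 ≤ n
  /-- the vertices, in cyclic order -/
  vertex : ZMod n → ℝ × ℝ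
  injective : Function.Injective vertex
  alternating : ∀ i : ZMod n,
    ((vertex i).2 = (vertex (i + 1)).2 ∧ (vertex (i + 1)).1 = (vertex (i + 2)).1) ∨
    ((vertex i).1 = (vertex (i + 1)).1 ∧ (vertex (i + 1)).2 = (vertex (i + 2)).2)
  simple : ∀ i j : ZMod n, i ≠ j →
    segment ℝ (vertex i) (vertex (i + 1)) ∩ segment ℝ (vertex j) (vertex (j + 1)) ⊆
      {vertex i, vertex (i + 1)} ∩ {vertex j, vertex (j + 1)}

/-- `x` and `y` have `r`-vision of each other in `D`: some non-degenerate axis-aligned (closed)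
rectangle contained in `D` contains both of them. -/
def RVisible (D : Set (ℝ × ℝ)) (x y : ℝ × ℝ) : Prop :=
  ∃ a b c d : ℝ, a < b ∧ c < d ∧ Set.Icc a b ×ˢ Set.Icc c d ⊆ D ∧
    x ∈ Set.Icc a b ×ˢ Set.Icc c d ∧ y ∈ Set.Icc a b ×ˢ Set.Icc c d

/-- `L` is a (closed, non-degenerate) vertical line segment. -/
def IsVerticalSegment (L : Set (ℝ × ℝ)) : Prop :=
  ∃ a c d : ℝ, c < d ∧ L = {a} ×ˢ Set.Icc c d

/-- `L` is a (closed, non-degenerate) horizontal line segment. -/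
def IsHorizontalSegment (L : Set (ℝ × ℝ)) : Prop :=
  ∃ a b c : ℝ, a < b ∧ L = Set.Icc a b ×ˢ {c}

/-- `L` is a maximal vertical line segment in `D`. -/
def IsMaximalVertical (D L : Set (ℝ × ℝ)) : Prop :=
  Maximal (fun M : Set (ℝ × ℝ) => IsVerticalSegment M ∧ M ⊆ D) L

/-- `L` is a maximal horizontal line segment in `D`. -/
def IsMaximalHorizontal (D L : Set (ℝ × ℝ)) : Prop :=
  Maximal (fun M : Set (ℝ × ℝ) => IsHorizontalSegment M ∧ M ⊆ D) L

namespace OrthogonalPolygon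

/-- The closed polygonal curve, i.e. the union of the sides. -/
def boundary (P : OrthogonalPolygon) : Set (ℝ × ℝ) :=
  ⋃ i : ZMod P.n, segment ℝ (P.vertex i) (P.vertex (i + 1))

/-- The rectilinear domain bounded by `P`: the closed region consisting of the curve and of the
points that it encloses, i.e. those whose connected component in the complement of the curve
is bounded. -/
def domain (P : OrthogonalPolygon) : Set (ℝ × ℝ) :=
  P.boundary ∪
    {x | x ∉ P.boundary ∧ Bornology.IsBounded (connectedComponentIn P.boundaryᶜ x)}

/-- A point `r`-guard: a point of the domain such that the maximal vertical and horizontal line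
segments in the domain through it contain no vertex. -/
def IsPointGuard (P : OrthogonalPolygon) (y : ℝ × ℝ) : Prop :=
  y ∈ P.domain ∧
    (∀ M, IsMaximalVertical P.domain M → y ∈ M → Disjoint M (Set.range P.vertex)) ∧
    (∀ M, IsMaximalHorizontal P.domain M → y ∈ M → Disjoint M (Set.range P.vertex))

/-- A vertical mobile `r`-guard: a vertical line segment in the domain such that the maximal
vertical line segment in the domain containing it contains no vertex. -/
def IsVerticalGuard (P : OrthogonalPolygon) (L : Set (ℝ × ℝ)) : Prop :=
  IsVerticalSegment L ∧ L ⊆ P.domain ∧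
    ∀ M, IsMaximalVertical P.domain M → L ⊆ M → Disjoint M (Set.range P.vertex)

/-- A horizontal mobile `r`-guard. -/
def IsHorizontalGuard (P : OrthogonalPolygon) (L : Set (ℝ × ℝ)) : Prop :=
  IsHorizontalSegment L ∧ L ⊆ P.domain ∧
    ∀ M, IsMaximalHorizontal P.domain M → L ⊆ M → Disjoint M (Set.range P.vertex)

/-- A point `r`-guard system: a set of point `r`-guards such that every point of the domain is
`r`-visible from one of them. -/
def IsPointGuardSystem (P : OrthogonalPolygon) (S : Set (ℝ × ℝ)) : Prop :=
  (∀ y ∈ S, P.IsPointGuard y) ∧ ∀ x ∈ P.domain, ∃ y ∈ S, RVisible P.domain x y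

/-- A vertical mobile `r`-guard system: a set of vertical mobile `r`-guards such that every point
of the domain is `r`-visible from some point of one of them. -/
def IsVerticalGuardSystem (P : OrthogonalPolygon) (S : Set (Set (ℝ × ℝ))) : Prop :=
  (∀ L ∈ S, P.IsVerticalGuard L) ∧ ∀ x ∈ P.domain, ∃ L ∈ S, ∃ y ∈ L, RVisible P.domain x y

/-- A horizontal mobile `r`-guard system. -/
def IsHorizontalGuardSystem (P : OrthogonalPolygon) (S : Set (Set (ℝ × ℝ))) : Prop :=
  (∀ L ∈ S, P.IsHorizontalGuard L) ∧ ∀ x ∈ P.domain, ∃ L ∈ S, ∃ y ∈ L, RVisible P.domain x y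

/-- `p`: the minimum size of a point `r`-guard system. -/
noncomputable def minPoint (P : OrthogonalPolygon) : ℕ∞ :=
  ⨅ (S : Set (ℝ × ℝ)) (_ : P.IsPointGuardSystem S), S.encard

/-- `m_V`: the minimum size of a vertical mobile `r`-guard system. -/
noncomputable def minVertical (P : OrthogonalPolygon) : ℕ∞ :=
  ⨅ (S : Set (Set (ℝ × ℝ))) (_ : P.IsVerticalGuardSystem S), S.encard

/-- `m_H`: the minimum size of a horizontal mobile `r`-guard system. -/
noncomputable def minHorizontal (P : OrthogonalPolygon) : ℕ∞ :=
  ⨅ (S : Set (Set (ℝ × ℝ))) (_ : P.IsHorizontalGuardSystem S), S.encard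

end OrthogonalPolygon

/-- The comb with `k` teeth: a horizontal handle `[0, 2k] × [0, 1]` together with the teeth
`[2i + 1, 2i + 2] × [-5, 0]` for `0 ≤ i < k`. -/
def comb (k : ℕ) : Set (ℝ × ℝ) :=
  Set.Icc 0 (2 * (k : ℝ)) ×ˢ Set.Icc 0 1 ∪
    ⋃ i : Fin k, Set.Icc (2 * (i : ℝ) + 1) (2 * (i : ℝ) + 2) ×ˢ Set.Icc (-5) 0

/-! Suppose one horizontal guard `L` at height `c` covers the domain. Stretching `L` along the
rectangles of visibility shows that every point `z` sees its own projection `(z.1, c)`. Hence a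
vertical guard on the line `x = u` can be traded for the point `(u, c)`. The maximal segments
through that point contain the vertical guard and `L`, so they avoid all vertices. A point that sees
`(u, t)` also sees `(u, c)`, because the rectangle it spans with `(u, c)` is swept out by vertical
segments lying in the domain (`RVisible.slide`). So `p ≤ m_V`, which is the bound when `m_H = 1`;
reflection in `x = y` gives the other case.

For the combs, `domain_eq_of_escape` identifies the region enclosed by an explicit polygon without
the Jordan curve theorem. The lower bounds for `p` and `m_V` hold because the bottom of each tooth
is seen only from the vertical strip of that tooth, and these strips are disjoint. The upper bounds
for `m_H` and `m_V` come from the middle line of the handle and the tooth axes; the one for `p`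
follows from the first half. -/

/-! ### Trading vertical guards for point guards -/

theorem Icc_min_max_subset {E : Set ℝ} {a b a' b' x s : ℝ} (h : Set.Icc a b ⊆ E)
    (h' : Set.Icc a' b' ⊆ E) (hx : x ∈ Set.Icc a' b') (hs : s ∈ Set.Icc a b)
    (hxs : Set.uIcc x s ⊆ E) : Set.Icc (min a a') (max b b') ⊆ E := by
  intro t ht
  obtain ⟨ht1, ht2⟩ := ht
  obtain ⟨hx1, hx2⟩ := hx
  obtain ⟨hs1, hs2⟩ := hs
  by_cases h1 : t ∈ Set.Icc a b
  · exact h h1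
  by_cases h2 : t ∈ Set.Icc a' b'
  · exact h' h2
  -- A point of the hull that misses both intervals lies in the gap between them, which `x` and `s`
  -- bridge.
  apply hxs
  rw [Set.mem_uIcc]
  simp only [Set.mem_Icc, not_and_or, not_le] at h1 h2
  rcases min_le_iff.1 ht1 with h3 | h3 <;> rcases le_max_iff.1 ht2 with h4 | h4 <;>
    rcases h1 with h1 | h1 <;> rcases h2 with h2 | h2 <;>
    first
    | (exfalso; linarith)
    | (left; constructor <;> linarith)
    | (right; constructor <;> linarith)

/-- The hull of `M` and the given segment is again a segment in `D`, so maximality of `M` absorbs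
it. -/
theorem IsMaximalHorizontal.subset_of_connected {D M : Set (ℝ × ℝ)} {a b c x s : ℝ}
    (hM : IsMaximalHorizontal D M) (hxM : (x, c) ∈ M) (hL : Set.Icc a b ×ˢ {c} ⊆ D)
    (hs : s ∈ Set.Icc a b) (hxs : ∀ t ∈ Set.uIcc x s, (t, c) ∈ D) :
    Set.Icc a b ×ˢ {c} ⊆ M := by
  obtain ⟨⟨⟨a', b', c', hab', rfl⟩, hMD⟩, hmax⟩ := hM
  obtain ⟨hx, hc⟩ := hxM
  obtain rfl : c = c' := hc
  have key : Set.Icc (min a a') (max b b') ⊆ {t | (t, c) ∈ D} :=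
    Icc_min_max_subset (fun t ht => hL ⟨ht, rfl⟩) (fun t ht => hMD ⟨ht, rfl⟩) hx hs hxs
  refine Set.Subset.trans ?_ (hmax (y := Set.Icc (min a a') (max b b') ×ˢ {c})
    ⟨⟨_, _, _, ?_, rfl⟩, ?_⟩ ?_)
  · exact Set.prod_mono (Set.Icc_subset_Icc (min_le_left _ _) (le_max_left _ _)) subset_rfl
  · exact (min_le_right _ _).trans_lt (hab'.trans_le (le_max_right _ _))
  · rintro ⟨t, u⟩ ⟨ht, hu⟩
    obtain rfl : u = c := hu
    exact key ht
  · exact Set.prod_mono (Set.Icc_subset_Icc (min_le_right _ _) (le_max_right _ _)) subset_rfl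

theorem IsMaximalVertical.subset_of_connected {D M : Set (ℝ × ℝ)} {a b c x s : ℝ}
    (hM : IsMaximalVertical D M) (hxM : (c, x) ∈ M) (hL : {c} ×ˢ Set.Icc a b ⊆ D)
    (hs : s ∈ Set.Icc a b) (hxs : ∀ t ∈ Set.uIcc x s, (c, t) ∈ D) :
    {c} ×ˢ Set.Icc a b ⊆ M := by
  obtain ⟨⟨⟨c', a', b', hab', rfl⟩, hMD⟩, hmax⟩ := hM
  obtain ⟨hc, hx⟩ := hxM
  obtain rfl : c = c' := hc
  have key : Set.Icc (min a a') (max b b') ⊆ {t | (c, t) ∈ D} :=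
    Icc_min_max_subset (fun t ht => hL ⟨rfl, ht⟩) (fun t ht => hMD ⟨rfl, ht⟩) hx hs hxs
  refine Set.Subset.trans ?_ (hmax (y := {c} ×ˢ Set.Icc (min a a') (max b b'))
    ⟨⟨_, _, _, ?_, rfl⟩, ?_⟩ ?_)
  · exact Set.prod_mono subset_rfl (Set.Icc_subset_Icc (min_le_left _ _) (le_max_left _ _))
  · exact (min_le_right _ _).trans_lt (hab'.trans_le (le_max_right _ _))
  · rintro ⟨u, t⟩ ⟨hu, ht⟩
    obtain rfl : u = c := hu
    exact key ht
  · exact Set.prod_mono subset_rfl (Set.Icc_subset_Icc (min_le_right _ _) (le_max_right _ _))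

/-- If every point of `D` is visible from the line at height `c`, a point that is visible from
`(u, t)` is visible from `(u, c)`. -/
theorem RVisible.slide {D : Set (ℝ × ℝ)} {c : ℝ}
    (hD : ∀ z ∈ D, RVisible D z (z.1, c)) {z : ℝ × ℝ} {u t : ℝ}
    (h : RVisible D z (u, t)) : RVisible D z (u, c) := by
  obtain ⟨a, b, d, e, hab, hde, hR, ⟨hz1, hz2⟩, ⟨hu, ht⟩⟩ := h
  obtain ⟨x, y⟩ := z
  simp only at hz1 hz2 hu ht
  have hzD : (x, y) ∈ D := hR ⟨hz1, hz2⟩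
  -- If `x = u` or `y = c`, the rectangle spanned by `z` and `(u, c)` is degenerate, and an already
  -- given rectangle serves instead.
  rcases eq_or_ne x u with rfl | hxu
  · exact hD _ hzD
  rcases eq_or_ne y c with rfl | hyc
  · exact ⟨a, b, d, e, hab, hde, hR, ⟨hz1, hz2⟩, ⟨hu, hz2⟩⟩
  refine ⟨min x u, max x u, min y c, max y c, ?_, ?_, ?_, ?_, ?_⟩
  · exact min_lt_max.2 hxu
  · exact min_lt_max.2 hyc
  · rintro ⟨v, w⟩ ⟨hv, hw⟩
    have hv' : v ∈ Set.Icc a b := Set.uIcc_subset_Icc hz1 hu hv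
    -- The column over `v`, from height `y` to height `c`, lies in `D` because `(v, y)` sees `(v,
    -- c)`.
    obtain ⟨a', b', d', e', -, -, hR', ⟨h1, h2⟩, ⟨h3, h4⟩⟩ := hD (v, y) (hR ⟨hv', hz2⟩)
    exact hR' ⟨h1, Set.uIcc_subset_Icc h2 h4 hw⟩
  · exact ⟨Set.left_mem_uIcc, Set.left_mem_uIcc⟩
  · exact ⟨Set.right_mem_uIcc, Set.right_mem_uIcc⟩

namespace OrthogonalPolygon

theorem domain_nonempty (P : OrthogonalPolygon) : P.domain.Nonempty :=
  ⟨P.vertex 0, Or.inl (Set.mem_iUnion.2 ⟨0, left_mem_segment ℝ _ _⟩)⟩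

/-- A single horizontal guard covering the domain lets one replace every vertical guard by a
point guard on the line of the horizontal guard. -/
theorem minPoint_le_minVertical (P : OrthogonalPolygon) (h : P.minHorizontal = 1) :
    P.minPoint ≤ P.minVertical := by
  -- An infimum below 2 yields a covering system with at most one guard.
  have hlt : P.minHorizontal < 2 := by rw [h]; norm_num
  obtain ⟨S, hS⟩ := iInf_lt_iff.1 hlt
  obtain ⟨⟨hg, hcov⟩, hcard⟩ := iInf_lt_iff.1 hS
  have hsub : S.Subsingleton :=
    Set.encard_le_one_iff_subsingleton.1
      (Order.le_of_lt_add_one (by simpa [one_add_one_eq_two] using hcard))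
  obtain ⟨z₀, hz₀⟩ := P.domain_nonempty
  obtain ⟨L, hLS, -⟩ := hcov z₀ hz₀
  obtain ⟨⟨a, b, c, hab, rfl⟩, hLD, hLM⟩ := hg L hLS
  have hvis : ∀ z ∈ P.domain, ∃ s ∈ Set.Icc a b, RVisible P.domain z (z.1, c) ∧
      ∀ t ∈ Set.uIcc z.1 s, (t, c) ∈ P.domain := by
    intro z hz
    obtain ⟨L', hL', ⟨s, c'⟩, hy, a', b', d', e', hab', hde', hR, hz', hs'⟩ := hcov z hz
    obtain rfl := hsub hLS hL'
    obtain ⟨hs, hc⟩ := hy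
    obtain rfl : c' = c := hc
    exact ⟨s, hs, ⟨a', b', d', e', hab', hde', hR, hz', ⟨hz'.1, hs'.2⟩⟩,
      fun t ht => hR ⟨Set.uIcc_subset_Icc hz'.1 hs'.1 ht, hs'.2⟩⟩
  have hD : ∀ z ∈ P.domain, RVisible P.domain z (z.1, c) := fun z hz =>
    let ⟨_, _, h, _⟩ := hvis z hz
    h
  refine le_iInf₂ fun T hT => ?_
  obtain ⟨hTg, hTcov⟩ := hT
  have key : ∀ V ∈ T, ∃ y, P.IsPointGuard y ∧
      ∀ x, (∃ v ∈ V, RVisible P.domain x v) → RVisible P.domain x y := by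
    intro V hV
    obtain ⟨⟨u, d, e, hde, rfl⟩, hVD, hVM⟩ := hTg V hV
    have hud : (u, d) ∈ P.domain := hVD ⟨rfl, le_rfl, hde.le⟩
    obtain ⟨s, hs, ⟨a', b', d', e', -, -, hR, h1, h2⟩, hus⟩ := hvis _ hud
    refine ⟨(u, c), ⟨hR h2, fun M hM hy => hVM M hM ?_, fun M hM hy => hLM M hM ?_⟩, ?_⟩
    -- The column from `(u, c)` to the end `(u, d)` of the vertical guard lies in the domain, since
    -- these two points see each other.
    · exact hM.subset_of_connected hy hVD (Set.left_mem_Icc.2 hde.le)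
        fun t ht => hR ⟨h1.1, Set.uIcc_subset_Icc h2.2 h1.2 ht⟩
    · exact hM.subset_of_connected hy hLD hs hus
    · rintro x ⟨⟨u', t⟩, ⟨hu, -⟩, hx⟩
      obtain rfl : u' = u := hu
      exact hx.slide hD
  choose! f hf1 hf2 using key
  refine (iInf₂_le (f '' T) ⟨?_, ?_⟩).trans (Set.encard_image_le f T)
  · rintro _ ⟨V, hV, rfl⟩
    exact hf1 V hV
  · intro x hx
    obtain ⟨V, hV, hv⟩ := hTcov x hx
    exact ⟨f V, ⟨V, hV, rfl⟩, hf2 V hV x hv⟩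

/-! ### Reflection in the diagonal -/

/-- The mirror image of a polygon in the line `x = y`. -/
def swap (P : OrthogonalPolygon) : OrthogonalPolygon where
  n := P.n
  four_le := P.four_le
  vertex i := (P.vertex i).swap
  injective := Prod.swap_injective.comp P.injective
  alternating i := (P.alternating i).symm
  simple i j hij := by
    have hseg : ∀ p q x : ℝ × ℝ, x ∈ segment ℝ p.swap q.swap → x.swap ∈ segment ℝ p q := by
      rintro p q x ⟨a, b, ha, hb, hab, rfl⟩
      exact ⟨a, b, ha, hb, hab, by ext <;> simp⟩
    rintro x ⟨h1, h2⟩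
    obtain ⟨h3, h4⟩ := P.simple i j hij ⟨hseg _ _ _ h1, hseg _ _ _ h2⟩
    simp only [Set.mem_insert_iff, Set.mem_singleton_iff] at h3 h4
    refine ⟨?_, ?_⟩
    · simpa only [Set.mem_insert_iff, Set.mem_singleton_iff, Prod.swap_eq_iff_eq_swap] using h3
    · simpa only [Set.mem_insert_iff, Set.mem_singleton_iff, Prod.swap_eq_iff_eq_swap] using h4

theorem boundary_swap (P : OrthogonalPolygon) :
    P.swap.boundary = Prod.swap ⁻¹' P.boundary := by
  have hseg : ∀ p q x : ℝ × ℝ, x ∈ segment ℝ p q → x.swap ∈ segment ℝ p.swap q.swap := by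
    rintro p q x ⟨a, b, ha, hb, hab, rfl⟩
    exact ⟨a, b, ha, hb, hab, by ext <;> simp⟩
  ext x
  simp only [boundary, Set.mem_preimage, Set.mem_iUnion]
  exact exists_congr fun i => ⟨fun h => hseg _ _ _ h, fun h => hseg _ _ _ h⟩

theorem domain_swap (P : OrthogonalPolygon) : P.swap.domain = Prod.swap ⁻¹' P.domain := by
  have hlip : LipschitzWith 1 (Prod.swap : ℝ × ℝ → ℝ × ℝ) := by
    simpa using! LipschitzWith.prod_snd.prodMk LipschitzWith.prod_fst
  have key : ∀ (B : Set (ℝ × ℝ)) (x : ℝ × ℝ), x ∉ B →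
      Bornology.IsBounded (connectedComponentIn Bᶜ x) →
      Bornology.IsBounded (connectedComponentIn (Prod.swap ⁻¹' B)ᶜ x.swap) := by
    intro B x hx h
    have h1 := (Homeomorph.prodComm ℝ ℝ).image_connectedComponentIn (s := Bᶜ) hx
    have h2 := hlip.isBounded_image h
    rw [Homeomorph.coe_prodComm] at h1
    rw [h1, Set.image_swap_eq_preimage_swap] at h2
    exact h2
  have aux : ∀ (Q : OrthogonalPolygon) (x : ℝ × ℝ), x ∈ Q.domain → x.swap ∈ Q.swap.domain := by
    rintro Q x (h | ⟨h1, h2⟩)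
    · left
      rw [boundary_swap]
      exact h
    · right
      rw [boundary_swap]
      exact ⟨h1, key _ _ h1 h2⟩
  ext x
  -- Reflecting twice gives back `P` definitionally, so `aux` yields both inclusions.
  exact ⟨fun h => aux P.swap x h, fun h => aux P _ h⟩

end OrthogonalPolygon

theorem RVisible.swap {D : Set (ℝ × ℝ)} {x y : ℝ × ℝ} (h : RVisible D x y) :
    RVisible (Prod.swap ⁻¹' D) x.swap y.swap := by
  obtain ⟨a, b, c, d, hab, hcd, hR, hx, hy⟩ := h
  exact ⟨c, d, a, b, hcd, hab, fun z hz => hR ⟨hz.2, hz.1⟩, ⟨hx.2, hx.1⟩, ⟨hy.2, hy.1⟩⟩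

theorem IsVerticalSegment.swap {L : Set (ℝ × ℝ)} (h : IsVerticalSegment L) :
    IsHorizontalSegment (Prod.swap ⁻¹' L) := by
  obtain ⟨a, c, d, hcd, rfl⟩ := h
  exact ⟨c, d, a, hcd, Set.preimage_swap_prod _ _⟩

theorem IsHorizontalSegment.swap {L : Set (ℝ × ℝ)} (h : IsHorizontalSegment L) :
    IsVerticalSegment (Prod.swap ⁻¹' L) := by
  obtain ⟨a, c, d, hcd, rfl⟩ := h
  exact ⟨d, a, c, hcd, Set.preimage_swap_prod _ _⟩

theorem IsMaximalVertical.swap {D M : Set (ℝ × ℝ)} (h : IsMaximalVertical D M) :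
    IsMaximalHorizontal (Prod.swap ⁻¹' D) (Prod.swap ⁻¹' M) :=
  ⟨⟨h.1.1.swap, Set.preimage_mono h.1.2⟩, fun _ hN hMN =>
    Set.preimage_mono (f := Prod.swap) (h.2 ⟨hN.1.swap, Set.preimage_mono (f := Prod.swap) hN.2⟩
      (Set.preimage_mono (f := Prod.swap) hMN))⟩

theorem IsMaximalHorizontal.swap {D M : Set (ℝ × ℝ)} (h : IsMaximalHorizontal D M) :
    IsMaximalVertical (Prod.swap ⁻¹' D) (Prod.swap ⁻¹' M) :=
  ⟨⟨h.1.1.swap, Set.preimage_mono h.1.2⟩, fun _ hN hMN =>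
    Set.preimage_mono (f := Prod.swap) (h.2 ⟨hN.1.swap, Set.preimage_mono (f := Prod.swap) hN.2⟩
      (Set.preimage_mono (f := Prod.swap) hMN))⟩

namespace OrthogonalPolygon

theorem disjoint_range_vertex_swap {P : OrthogonalPolygon} {M : Set (ℝ × ℝ)}
    (h : Disjoint (Prod.swap ⁻¹' M) (Set.range P.vertex)) :
    Disjoint M (Set.range P.swap.vertex) := by
  rw [Set.disjoint_right] at h ⊢
  rintro _ ⟨i, rfl⟩
  exact h ⟨i, rfl⟩

theorem IsPointGuard.swap {P : OrthogonalPolygon} {y : ℝ × ℝ} (h : P.IsPointGuard y) :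
    P.swap.IsPointGuard y.swap := by
  obtain ⟨h1, h2, h3⟩ := h
  unfold IsPointGuard
  rw [domain_swap]
  exact ⟨h1, fun M hM hy => disjoint_range_vertex_swap (h3 _ hM.swap hy),
    fun M hM hy => disjoint_range_vertex_swap (h2 _ hM.swap hy)⟩

theorem IsVerticalGuard.swap {P : OrthogonalPolygon} {L : Set (ℝ × ℝ)}
    (h : P.IsVerticalGuard L) : P.swap.IsHorizontalGuard (Prod.swap ⁻¹' L) := by
  obtain ⟨h1, h2, h3⟩ := h
  unfold IsHorizontalGuard
  rw [domain_swap]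
  exact ⟨h1.swap, Set.preimage_mono h2, fun M hM hL => disjoint_range_vertex_swap
    (h3 _ hM.swap (Set.preimage_mono (f := Prod.swap) hL))⟩

theorem IsHorizontalGuard.swap {P : OrthogonalPolygon} {L : Set (ℝ × ℝ)}
    (h : P.IsHorizontalGuard L) : P.swap.IsVerticalGuard (Prod.swap ⁻¹' L) := by
  obtain ⟨h1, h2, h3⟩ := h
  unfold IsVerticalGuard
  rw [domain_swap]
  exact ⟨h1.swap, Set.preimage_mono h2, fun M hM hL => disjoint_range_vertex_swap
    (h3 _ hM.swap (Set.preimage_mono (f := Prod.swap) hL))⟩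

theorem minPoint_swap (P : OrthogonalPolygon) : P.swap.minPoint = P.minPoint := by
  have key : ∀ Q : OrthogonalPolygon, Q.swap.minPoint ≤ Q.minPoint := by
    intro Q
    refine le_iInf₂ fun S hS => ?_
    refine (iInf₂_le (Prod.swap '' S) ⟨?_, ?_⟩).trans (Set.encard_image_le _ S)
    · rintro _ ⟨y, hy, rfl⟩
      exact (hS.1 y hy).swap
    · rw [domain_swap]
      intro x hx
      obtain ⟨y, hy, hxy⟩ := hS.2 _ hx
      exact ⟨y.swap, ⟨y, hy, rfl⟩, hxy.swap⟩
  exact (key P).antisymm (key P.swap)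

theorem minVertical_swap_le (P : OrthogonalPolygon) : P.swap.minVertical ≤ P.minHorizontal := by
  refine le_iInf₂ fun S hS => ?_
  refine (iInf₂_le ((Prod.swap ⁻¹' ·) '' S) ⟨?_, ?_⟩).trans (Set.encard_image_le _ S)
  · rintro _ ⟨L, hL, rfl⟩
    exact (hS.1 L hL).swap
  · rw [domain_swap]
    intro x hx
    obtain ⟨L, hL, y, hy, hxy⟩ := hS.2 _ hx
    exact ⟨_, ⟨L, hL, rfl⟩, y.swap, hy, hxy.swap⟩

theorem minHorizontal_swap_le (P : OrthogonalPolygon) :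
    P.swap.minHorizontal ≤ P.minVertical := by
  refine le_iInf₂ fun S hS => ?_
  refine (iInf₂_le ((Prod.swap ⁻¹' ·) '' S) ⟨?_, ?_⟩).trans (Set.encard_image_le _ S)
  · rintro _ ⟨L, hL, rfl⟩
    exact (hS.1 L hL).swap
  · rw [domain_swap]
    intro x hx
    obtain ⟨L, hL, y, hy, hxy⟩ := hS.2 _ hx
    exact ⟨_, ⟨L, hL, rfl⟩, y.swap, hy, hxy.swap⟩

theorem minVertical_swap (P : OrthogonalPolygon) : P.swap.minVertical = P.minHorizontal :=
  P.minVertical_swap_le.antisymm P.swap.minHorizontal_swap_le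

theorem minHorizontal_swap (P : OrthogonalPolygon) : P.swap.minHorizontal = P.minVertical :=
  P.minHorizontal_swap_le.antisymm P.swap.minVertical_swap_le

theorem minPoint_le_minHorizontal (P : OrthogonalPolygon) (h : P.minVertical = 1) :
    P.minPoint ≤ P.minHorizontal := by
  rw [← minPoint_swap, ← minVertical_swap]
  exact P.swap.minPoint_le_minVertical (P.minHorizontal_swap.trans h)

/-! ### Recognising the enclosed region -/

/-- A compact set bounded by the curve of `P`, from whose complement one can escape to infinity,
is the domain of `P`. -/
theorem domain_eq_of_escape (P : OrthogonalPolygon) {K : Set (ℝ × ℝ)} (hK : IsCompact K)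
    (hPK : P.boundary ⊆ K) (hint : K \ P.boundary ⊆ interior K)
    (hesc : ∀ x ∉ K, ∃ C : Set (ℝ × ℝ), IsPreconnected C ∧ x ∈ C ∧ C ⊆ Kᶜ ∧
      ¬ Bornology.IsBounded C) : P.domain = K := by
  ext x
  constructor
  · rintro (h | ⟨h1, h2⟩)
    · exact hPK h
    · by_contra hx
      obtain ⟨C, hC, hxC, hCK, hCb⟩ := hesc x hx
      exact hCb (h2.subset (hC.subset_connectedComponentIn hxC
        (hCK.trans (Set.compl_subset_compl.2 hPK))))
  · intro hx
    by_cases hb : x ∈ P.boundary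
    · exact Or.inl hb
    refine Or.inr ⟨hb, hK.isBounded.subset ?_⟩
    -- Off the curve, the plane is covered by the disjoint open sets `interior K` and `Kᶜ`; a
    -- component that meets the first stays in it and is bounded.
    refine (isPreconnected_connectedComponentIn.subset_left_of_subset_union
      isOpen_interior hK.isClosed.isOpen_compl ?_ ?_ ?_).trans interior_subset
    · exact disjoint_compl_right.mono_left interior_subset
    · intro z hz
      have hzb : z ∉ P.boundary := connectedComponentIn_subset _ _ hz
      by_cases hzK : z ∈ K
      · exact Or.inl (hint ⟨hzK, hzb⟩)
      · exact Or.inr hzK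
    · exact ⟨x, mem_connectedComponentIn hb, hint ⟨hx, hb⟩⟩

end OrthogonalPolygon

/-! ### The boundary polygon of a comb -/

theorem segment_mk_left (a c d : ℝ) :
    segment ℝ ((a, c) : ℝ × ℝ) (a, d) = {a} ×ˢ Set.uIcc c d := by
  rw [← Prod.image_mk_segment_right, segment_eq_uIcc, Set.singleton_prod]

theorem segment_mk_right (a b c : ℝ) :
    segment ℝ ((a, c) : ℝ × ℝ) (b, c) = Set.uIcc a b ×ˢ {c} := by
  rw [← Prod.image_mk_segment_left, segment_eq_uIcc, Set.prod_singleton]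

/-- The height of the `j`-th vertex of the comb with `k` teeth. -/
noncomputable def combHeight (k j : ℕ) : ℝ :=
  if j = 0 ∨ j = 4 * k + 1 then 1 else if j % 4 = 1 ∨ j % 4 = 2 then 0 else -5

/-- The `j`-th vertex of the comb with `k` teeth, starting at the upper left corner and running
counterclockwise. -/
noncomputable def combVertex (k j : ℕ) : ℝ × ℝ := (((j / 2 : ℕ) : ℝ), combHeight k j)

theorem combHeight_of_outer {k j : ℕ} (h : j = 0 ∨ j = 4 * k + 1) : combHeight k j = 1 :=
  if_pos h

theorem combHeight_of_mod {k j : ℕ} (h : j ≠ 0) (h' : j ≠ 4 * k + 1)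
    (h4 : j % 4 = 1 ∨ j % 4 = 2) : combHeight k j = 0 := by
  rw [combHeight, if_neg (by tauto), if_pos h4]

theorem combHeight_of_not_mod {k j : ℕ} (h : j ≠ 0) (h' : j ≠ 4 * k + 1)
    (h4 : ¬ (j % 4 = 1 ∨ j % 4 = 2)) : combHeight k j = -5 := by
  rw [combHeight, if_neg (by tauto), if_neg h4]

theorem combHeight_nonpos {k j : ℕ} (h : j ≠ 0) (h' : j ≠ 4 * k + 1) : combHeight k j ≤ 0 := by
  by_cases h4 : j % 4 = 1 ∨ j % 4 = 2
  · rw [combHeight_of_mod h h' h4]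
  · rw [combHeight_of_not_mod h h' h4]
    norm_num

theorem combHeight_le_one (k j : ℕ) : combHeight k j ≤ 1 := by
  unfold combHeight
  split_ifs <;> norm_num

theorem combHeight_ge (k j : ℕ) : -5 ≤ combHeight k j := by
  unfold combHeight
  split_ifs <;> norm_num

theorem combHeight_succ_of_odd {k j : ℕ} (hj : j < 4 * k) (hodd : j % 2 = 1) :
    combHeight k (j + 1) = combHeight k j := by
  rcases (by omega : j % 4 = 1 ∨ j % 4 = 3) with h | h
  · rw [combHeight_of_mod (by omega) (by omega) (by omega),
      combHeight_of_mod (by omega) (by omega) (by omega)]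
  · rw [combHeight_of_not_mod (by omega) (by omega) (by omega),
      combHeight_of_not_mod (by omega) (by omega) (by omega)]

/-- Successive horizontal sides `j` and `j + 2` share an abscissa, so only their heights keep them
disjoint. -/
theorem combHeight_ne_of_odd {k j : ℕ} (hj : j + 2 < 4 * k) (hodd : j % 2 = 1) :
    combHeight k j ≠ combHeight k (j + 2) := by
  rcases (by omega : j % 4 = 1 ∨ j % 4 = 3) with h | h
  · rw [combHeight_of_mod (by omega) (by omega) (by omega),
      combHeight_of_not_mod (by omega) (by omega) (by omega)]
    norm_num
  · rw [combHeight_of_not_mod (by omega) (by omega) (by omega),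
      combHeight_of_mod (by omega) (by omega) (by omega)]
    norm_num

theorem combHeight_ne_of_even {k j : ℕ} (hk : 1 ≤ k) (hj : j ≤ 4 * k) (heven : j % 2 = 0) :
    combHeight k j ≠ combHeight k (j + 1) := by
  rcases eq_or_ne j 0 with rfl | h0
  · rw [combHeight_of_outer (Or.inl rfl), combHeight_of_mod (by omega) (by omega) (by omega)]
    norm_num
  rcases eq_or_ne j (4 * k) with rfl | h1
  · rw [combHeight_of_outer (Or.inr rfl), combHeight_of_not_mod (by omega) (by omega) (by omega)]
    norm_num
  rcases (by omega : j % 4 = 0 ∨ j % 4 = 2) with h | h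
  · rw [combHeight_of_not_mod (by omega) (by omega) (by omega),
      combHeight_of_mod (by omega) (by omega) (by omega)]
    norm_num
  · rw [combHeight_of_mod (by omega) (by omega) (by omega),
      combHeight_of_not_mod (by omega) (by omega) (by omega)]
    norm_num

theorem combVertex_injOn {k i j : ℕ} (hk : 1 ≤ k) (hi : i < 4 * k + 2) (hj : j < 4 * k + 2)
    (h : combVertex k i = combVertex k j) : i = j := by
  have h1 : i / 2 = j / 2 := Nat.cast_injective (R := ℝ) (congrArg Prod.fst h)
  have h2 : combHeight k i = combHeight k j := congrArg Prod.snd h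
  by_contra hij
  -- Each abscissa `m` carries only the vertices `2m` and `2m + 1`, the two ends of a vertical side.
  rcases (by omega : (j = i + 1 ∧ i % 2 = 0) ∨ (i = j + 1 ∧ j % 2 = 0)) with ⟨rfl, h3⟩ | ⟨rfl, h3⟩
  · exact combHeight_ne_of_even hk (by omega) h3 h2
  · exact combHeight_ne_of_even hk (by omega) h3 h2.symm

/-- The index following `j` on the comb with `k` teeth. -/
def combNext (k j : ℕ) : ℕ := if j = 4 * k + 1 then 0 else j + 1

/-- The `j`-th side of the comb with `k` teeth. -/
def combSide (k j : ℕ) : Set (ℝ × ℝ) :=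
  segment ℝ (combVertex k j) (combVertex k (combNext k j))

theorem combNext_of_ne {k j : ℕ} (h : j ≠ 4 * k + 1) : combNext k j = j + 1 := if_neg h

theorem combSide_of_even {k j : ℕ} (heven : j % 2 = 0) :
    combSide k j = {((j / 2 : ℕ) : ℝ)} ×ˢ Set.uIcc (combHeight k j) (combHeight k (j + 1)) := by
  rw [combSide, combNext_of_ne (by omega), combVertex, combVertex,
    show (j + 1) / 2 = j / 2 by omega, segment_mk_left]

theorem combSide_of_odd {k j : ℕ} (hj : j < 4 * k) (hodd : j % 2 = 1) :
    combSide k j = Set.Icc ((j / 2 : ℕ) : ℝ) ((j / 2 : ℕ) + 1) ×ˢ {combHeight k j} := by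
  rw [combSide, combNext_of_ne (by omega), combVertex, combVertex,
    show (j + 1) / 2 = j / 2 + 1 by omega, combHeight_succ_of_odd hj hodd, segment_mk_right,
    Set.uIcc_of_le (by simp), Nat.cast_add, Nat.cast_one]

theorem combSide_last (k : ℕ) :
    combSide k (4 * k + 1) = Set.Icc 0 (2 * (k : ℝ)) ×ˢ {1} := by
  rw [combSide, combNext, if_pos rfl, combVertex, combVertex,
    combHeight_of_outer (Or.inl rfl), combHeight_of_outer (Or.inr rfl),
    show (4 * k + 1) / 2 = 2 * k by omega, segment_mk_right, Set.uIcc_comm]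
  simp [Set.uIcc_of_le]

/-- Apart from the top side, even sides are vertical with distinct abscissae, and odd sides are
horizontal over successive unit intervals. Abscissae alone then restrict contact to neighbouring
sides, or to two successive horizontal ones, which differ in height. -/
theorem combSide_inter {k i j : ℕ} (hij : i < j) (hj : j < 4 * k + 2) :
    combSide k i ∩ combSide k j ⊆ {combVertex k i, combVertex k (combNext k i)} ∩
      {combVertex k j, combVertex k (combNext k j)} := by
  rintro ⟨x, y⟩ ⟨hi', hj'⟩
  simp only [Set.mem_inter_iff, Set.mem_insert_iff, Set.mem_singleton_iff]
  rw [combNext_of_ne (by omega : i ≠ 4 * k + 1)]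
  have hi2 := Nat.mod_two_eq_zero_or_one i
  have hj2 := Nat.mod_two_eq_zero_or_one j
  rcases eq_or_ne j (4 * k + 1) with rfl | hjl
  · rw [combSide_last] at hj'
    obtain ⟨⟨hx0, hx1⟩, hy⟩ := hj'
    obtain rfl : y = 1 := hy
    rcases hi2 with hi2 | hi2
    · rw [combSide_of_even hi2] at hi'
      obtain ⟨hx, hy⟩ := hi'
      obtain rfl : x = _ := hx
      rcases eq_or_ne i 0 with rfl | h0
      · rw [show combNext k (4 * k + 1) = 0 from if_pos rfl]
        have : ((((0 / 2 : ℕ) : ℝ), 1) : ℝ × ℝ) = combVertex k 0 := by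
          rw [combVertex, combHeight_of_outer (Or.inl rfl)]
        exact ⟨Or.inl this, Or.inr this⟩
      rcases eq_or_ne i (4 * k) with rfl | h1
      · have : ((((4 * k / 2 : ℕ) : ℝ), 1) : ℝ × ℝ) = combVertex k (4 * k + 1) := by
          rw [combVertex, combHeight_of_outer (Or.inr rfl),
            show (4 * k + 1) / 2 = 4 * k / 2 by omega]
        exact ⟨Or.inr this, Or.inl this⟩
      · exfalso
        have h2 := combHeight_nonpos (k := k) h0 (by omega)
        have h3 := combHeight_nonpos (k := k) (by omega : i + 1 ≠ 0) (by omega)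
        have h4 := hy.2
        have h5 := sup_le h2 h3
        exact absurd (h4.trans h5) (by norm_num)
    · rw [combSide_of_odd (by omega) hi2] at hi'
      have h1 : (1 : ℝ) = _ := hi'.2
      have h2 := combHeight_nonpos (k := k) (by omega : i ≠ 0) (by omega)
      exfalso
      linarith
  rw [combNext_of_ne hjl]
  rcases hi2 with hi2 | hi2 <;> rcases hj2 with hj2 | hj2
  · rw [combSide_of_even hi2] at hi'
    rw [combSide_of_even hj2] at hj'
    have h : ((i / 2 : ℕ) : ℝ) = ((j / 2 : ℕ) : ℝ) := hi'.1.symm.trans hj'.1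
    rw [Nat.cast_inj] at h
    omega
  · rw [combSide_of_even hi2] at hi'
    rw [combSide_of_odd (by omega) hj2] at hj'
    obtain ⟨hx, -⟩ := hi'
    obtain ⟨⟨hx', -⟩, hy⟩ := hj'
    obtain rfl : x = _ := hx
    obtain rfl : y = _ := hy
    have h : j / 2 ≤ i / 2 := Nat.cast_le.1 hx'
    obtain rfl : j = i + 1 := by omega
    have : ((((i / 2 : ℕ) : ℝ), combHeight k (i + 1)) : ℝ × ℝ) = combVertex k (i + 1) := by
      rw [combVertex, show (i + 1) / 2 = i / 2 by omega]
    exact ⟨Or.inr this, Or.inl this⟩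
  · rw [combSide_of_odd (by omega) hi2] at hi'
    rw [combSide_of_even hj2] at hj'
    obtain ⟨hx, -⟩ := hj'
    obtain ⟨⟨-, hx'⟩, hy⟩ := hi'
    obtain rfl : x = _ := hx
    obtain rfl : y = _ := hy
    simp only at hx'
    have h : j / 2 ≤ i / 2 + 1 := by exact_mod_cast hx'
    obtain rfl : j = i + 1 := by omega
    have : (((((i + 1) / 2 : ℕ) : ℝ), combHeight k i) : ℝ × ℝ) = combVertex k (i + 1) := by
      rw [combVertex, combHeight_succ_of_odd (by omega) hi2]
    exact ⟨Or.inr this, Or.inl this⟩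
  · rw [combSide_of_odd (by omega) hi2] at hi'
    rw [combSide_of_odd (by omega) hj2] at hj'
    obtain ⟨⟨hx, -⟩, hy⟩ := hj'
    obtain ⟨⟨-, hx'⟩, hy'⟩ := hi'
    have h : j / 2 ≤ i / 2 + 1 := by exact_mod_cast hx.trans hx'
    obtain rfl : j = i + 2 := by omega
    exact absurd (Eq.trans (Eq.symm hy') hy) (combHeight_ne_of_odd (by omega) hi2)

theorem val_add_one_comb {k : ℕ} (i : ZMod (4 * k + 2)) : (i + 1).val = combNext k i.val := by
  have : Fact (1 < 4 * k + 2) := ⟨by omega⟩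
  have hi := i.val_lt
  rw [ZMod.val_add, ZMod.val_one, combNext]
  split_ifs with h
  · rw [h]
    exact Nat.mod_self _
  · exact Nat.mod_eq_of_lt (by omega)

/-- The boundary polygon of the comb with `k` teeth. -/
noncomputable def combPolygon (k : ℕ) (hk : 1 ≤ k) : OrthogonalPolygon where
  n := 4 * k + 2
  four_le := by omega
  vertex i := combVertex k i.val
  injective i j h := ZMod.val_injective _ (combVertex_injOn hk i.val_lt j.val_lt h)
  alternating i := by
    have h2 : i + 2 = i + 1 + 1 := by ring
    have hi := i.val_lt
    rw [h2, val_add_one_comb (i + 1), val_add_one_comb i]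
    generalize i.val = j at hi
    simp only [combVertex, Nat.cast_inj]
    rcases Nat.mod_two_eq_zero_or_one j with hj | hj
    · right
      rw [combNext_of_ne (by omega : j ≠ 4 * k + 1)]
      refine ⟨by omega, ?_⟩
      rcases eq_or_ne j (4 * k) with rfl | h
      · rw [combNext, if_pos rfl, combHeight_of_outer (Or.inl rfl), combHeight_of_outer (Or.inr rfl)]
      · rw [combNext_of_ne (by omega),
          combHeight_succ_of_odd (j := j + 1) (by omega) (by omega)]
    · left
      rcases eq_or_ne j (4 * k + 1) with rfl | h
      · rw [show combNext k (4 * k + 1) = 0 from if_pos rfl, combNext_of_ne (by omega),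
          combHeight_of_outer (Or.inl rfl), combHeight_of_outer (Or.inr rfl)]
        simp
      · rw [combNext_of_ne h, combNext_of_ne (by omega), combHeight_succ_of_odd (by omega) hj]
        exact ⟨rfl, by omega⟩
  simple i j hij := by
    have hv : i.val ≠ j.val := fun h => hij (ZMod.val_injective _ h)
    have hi := i.val_lt
    have hj := j.val_lt
    rw [val_add_one_comb, val_add_one_comb]
    rcases lt_or_gt_of_ne hv with h | h
    · exact combSide_inter h hj
    · rw [Set.inter_comm, Set.inter_comm {combVertex k i.val, _}]
      exact combSide_inter h hi

theorem mem_combPolygon_boundary {k : ℕ} (hk : 1 ≤ k) {x : ℝ × ℝ} :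
    x ∈ (combPolygon k hk).boundary ↔ ∃ j < 4 * k + 2, x ∈ combSide k j := by
  rw [OrthogonalPolygon.boundary, Set.mem_iUnion]
  constructor
  · rintro ⟨i, hi⟩
    refine ⟨ZMod.val (n := 4 * k + 2) i, ZMod.val_lt (n := 4 * k + 2) i, ?_⟩
    have hs := val_add_one_comb (k := k) i
    rw [combSide, ← hs]
    exact hi
  · rintro ⟨j, hj, h⟩
    refine ⟨((j : ℕ) : ZMod (4 * k + 2)), ?_⟩
    rw [combSide] at h
    have hv : ((j : ℕ) : ZMod (4 * k + 2)).val = j := ZMod.val_cast_of_lt hj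
    have hs := val_add_one_comb ((j : ℕ) : ZMod (4 * k + 2))
    rw [hv] at hs
    rw [← hs] at h
    change x ∈ segment ℝ (combVertex k ((j : ℕ) : ZMod (4 * k + 2)).val) _
    rw [hv]
    exact h

/-! ### The comb as the domain of its polygon -/

theorem mem_comb_handle {k : ℕ} {x y : ℝ} (hx : x ∈ Set.Icc 0 (2 * (k : ℝ)))
    (hy : y ∈ Set.Icc (0 : ℝ) 1) : (x, y) ∈ comb k := Or.inl ⟨hx, hy⟩

theorem comb_tooth_subset {k i : ℕ} (hi : i < k) :
    Set.Icc (2 * (i : ℝ) + 1) (2 * (i : ℝ) + 2) ×ˢ Set.Icc (-5) 1 ⊆ comb k := by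
  rintro ⟨x, y⟩ ⟨⟨hx1, hx2⟩, hy1, hy2⟩
  have hi' : (i : ℝ) + 1 ≤ k := by exact_mod_cast hi
  have hi0 : (0 : ℝ) ≤ i := Nat.cast_nonneg i
  simp only at hx1 hx2 hy1 hy2
  rcases le_total 0 y with h | h
  · exact mem_comb_handle ⟨by linarith, by linarith⟩ ⟨h, hy2⟩
  · exact Or.inr (Set.mem_iUnion.2 ⟨⟨i, hi⟩, ⟨hx1, hx2⟩, hy1, h⟩)

theorem mem_comb_of_neg {k : ℕ} {x y : ℝ} (h : (x, y) ∈ comb k) (hy : y < 0) :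
    ∃ i < k, 2 * (i : ℝ) + 1 ≤ x ∧ x ≤ 2 * (i : ℝ) + 2 := by
  rcases h with h | h
  · exact absurd h.2.1 (not_le.2 hy)
  · obtain ⟨i, hx, -⟩ := Set.mem_iUnion.1 h
    exact ⟨i, i.2, hx.1, hx.2⟩

theorem isCompact_comb (k : ℕ) : IsCompact (comb k) :=
  (isCompact_Icc.prod isCompact_Icc).union
    (isCompact_iUnion fun _ => isCompact_Icc.prod isCompact_Icc)

theorem combPolygon_boundary_subset {k : ℕ} (hk : 1 ≤ k) :
    (combPolygon k hk).boundary ⊆ comb k := by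
  rintro ⟨x, y⟩ h
  obtain ⟨j, hj, h⟩ := (mem_combPolygon_boundary hk).1 h
  have hk' : (1 : ℝ) ≤ k := by exact_mod_cast hk
  rcases eq_or_ne j (4 * k + 1) with rfl | hjl
  · rw [combSide_last] at h
    obtain rfl : y = 1 := h.2
    exact mem_comb_handle h.1 ⟨zero_le_one, le_rfl⟩
  rcases eq_or_ne j 0 with rfl | hj0
  · rw [combSide_of_even rfl, combHeight_of_outer (Or.inl rfl),
      combHeight_of_mod (by omega) (by omega) (by omega), Set.uIcc_of_ge zero_le_one] at h
    obtain rfl : x = ((0 / 2 : ℕ) : ℝ) := h.1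
    exact mem_comb_handle ⟨by simp, by simp⟩ h.2
  -- For tooth `i`, the values `r = 1, 2, 3, 4` are the handle floor to its left, its left wall, its
  -- bottom and its right wall.
  obtain ⟨i, r, hr, rfl⟩ : ∃ i r, (r = 1 ∨ r = 2 ∨ r = 3 ∨ r = 4) ∧ j = 4 * i + r :=
    ⟨(j - 1) / 4, (j - 1) % 4 + 1, by omega, by omega⟩
  have hik : i < k := by omega
  have hi' : (i : ℝ) + 1 ≤ k := by exact_mod_cast hik
  have hi0 : (0 : ℝ) ≤ i := Nat.cast_nonneg i
  have hy : ∀ j, y ∈ Set.uIcc (combHeight k j) (combHeight k (j + 1)) → y ∈ Set.Icc (-5 : ℝ) 1 :=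
    fun j hj => Set.uIcc_subset_Icc ⟨combHeight_ge _ _, combHeight_le_one _ _⟩
      ⟨combHeight_ge _ _, combHeight_le_one _ _⟩ hj
  rcases hr with rfl | rfl | rfl | rfl
  · rw [combSide_of_odd (by omega) (by omega),
      combHeight_of_mod (by omega) (by omega) (by omega)] at h
    obtain ⟨⟨h1, h2⟩, hy⟩ := h
    obtain rfl : y = 0 := hy
    rw [show (4 * i + 1) / 2 = 2 * i by omega] at h1 h2
    push_cast at h1 h2
    exact mem_comb_handle ⟨by linarith, by linarith⟩ ⟨le_rfl, zero_le_one⟩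
  · rw [combSide_of_even (by omega)] at h
    obtain ⟨h1, h2⟩ := h
    obtain rfl : x = _ := h1
    refine comb_tooth_subset hik ⟨?_, hy _ h2⟩
    rw [show (4 * i + 2) / 2 = 2 * i + 1 by omega]
    push_cast
    constructor <;> linarith
  · rw [combSide_of_odd (by omega) (by omega),
      combHeight_of_not_mod (by omega) (by omega) (by omega)] at h
    obtain ⟨⟨h1, h2⟩, hy⟩ := h
    obtain rfl : y = -5 := hy
    rw [show (4 * i + 3) / 2 = 2 * i + 1 by omega] at h1 h2
    push_cast at h1 h2
    exact comb_tooth_subset hik ⟨⟨h1, by linarith⟩, by norm_num, by norm_num⟩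
  · rw [combSide_of_even (by omega)] at h
    obtain ⟨h1, h2⟩ := h
    obtain rfl : x = _ := h1
    refine comb_tooth_subset hik ⟨?_, hy _ h2⟩
    rw [show (4 * i + 4) / 2 = 2 * i + 2 by omega]
    push_cast
    constructor <;> linarith

theorem mem_interior_comb_of_tooth {k i : ℕ} (hi : i < k) {x y : ℝ} (hx1 : 2 * (i : ℝ) + 1 < x)
    (hx2 : x < 2 * (i : ℝ) + 2) (hy1 : -5 < y) (hy2 : y < 1) : (x, y) ∈ interior (comb k) :=
  mem_interior.2 ⟨Set.Ioo (2 * (i : ℝ) + 1) (2 * (i : ℝ) + 2) ×ˢ Set.Ioo (-5) 1,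
    (Set.prod_mono Set.Ioo_subset_Icc_self Set.Ioo_subset_Icc_self).trans (comb_tooth_subset hi),
    isOpen_Ioo.prod isOpen_Ioo, ⟨hx1, hx2⟩, hy1, hy2⟩

theorem comb_diff_boundary_subset {k : ℕ} (hk : 1 ≤ k) :
    comb k \ (combPolygon k hk).boundary ⊆ interior (comb k) := by
  rintro ⟨x, y⟩ ⟨hx, hb⟩
  rw [mem_combPolygon_boundary] at hb
  push Not at hb
  have hk' : (1 : ℝ) ≤ k := by exact_mod_cast hk
  -- The right end of the handle and the right wall of the last tooth form the single side `4 * k`.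
  have hright : x = 2 * k → ¬ (-5 ≤ y ∧ y ≤ 1) := by
    rintro rfl ⟨hy1, hy2⟩
    refine hb (4 * k) (by omega) ?_
    rw [combSide_of_even (by omega), combHeight_of_outer (Or.inr rfl),
      combHeight_of_not_mod (by omega) (by omega) (by omega), Set.uIcc_of_le (by norm_num)]
    refine ⟨?_, hy1, hy2⟩
    rw [show 4 * k / 2 = 2 * k by omega]
    simp
  rcases hx with ⟨⟨hx1, hx2⟩, hy1, hy2⟩ | hx
  · simp only at hx1 hx2 hy1 hy2
    have hx1 : 0 < x := by
      refine hx1.lt_of_ne ?_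
      rintro rfl
      refine hb 0 (by omega) ?_
      rw [combSide_of_even rfl, combHeight_of_outer (Or.inl rfl),
        combHeight_of_mod (by omega) (by omega) (by omega), Set.uIcc_of_ge zero_le_one]
      exact ⟨by simp, hy1, hy2⟩
    have hx2 : x < 2 * k := hx2.lt_of_ne fun h => hright h ⟨by linarith, hy2⟩
    have hy2 : y < 1 := by
      refine hy2.lt_of_ne ?_
      rintro rfl
      refine hb (4 * k + 1) (by omega) ?_
      rw [combSide_last]
      exact ⟨⟨hx1.le, hx2.le⟩, rfl⟩
    rcases hy1.eq_or_lt with rfl | hy1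
    -- On the line `y = 0`, each block `[2i, 2i + 2)` consists of floor, which is boundary, followed
    -- by the mouth of tooth `i`.
    · obtain ⟨i, hi1, hi2⟩ : ∃ i : ℕ, 2 * (i : ℝ) ≤ x ∧ x < 2 * (i : ℝ) + 2 := by
        refine ⟨⌊x / 2⌋₊, ?_, ?_⟩
        · linarith [Nat.floor_le (by linarith : 0 ≤ x / 2)]
        · linarith [Nat.lt_floor_add_one (x / 2)]
      have hik : i < k := by
        have : (i : ℝ) < k := by linarith
        exact_mod_cast this
      refine mem_interior_comb_of_tooth hik ?_ hi2 (by norm_num) hy2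
      by_contra h
      refine hb (4 * i + 1) (by omega) ?_
      rw [combSide_of_odd (by omega) (by omega),
        combHeight_of_mod (by omega) (by omega) (by omega), show (4 * i + 1) / 2 = 2 * i by omega]
      push_cast
      exact ⟨⟨hi1, not_lt.1 h⟩, rfl⟩
    · exact mem_interior.2 ⟨Set.Ioo 0 (2 * (k : ℝ)) ×ˢ Set.Ioo 0 1,
        fun z hz => Or.inl ⟨Set.Ioo_subset_Icc_self hz.1, Set.Ioo_subset_Icc_self hz.2⟩,
        isOpen_Ioo.prod isOpen_Ioo, ⟨hx1, hx2⟩, hy1, hy2⟩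
  · obtain ⟨⟨i, hik⟩, ⟨hx1, hx2⟩, hy1, hy2⟩ := Set.mem_iUnion.1 hx
    simp only at hx1 hx2 hy1 hy2
    refine mem_interior_comb_of_tooth hik (hx1.lt_of_ne ?_) (hx2.lt_of_ne ?_) (hy1.lt_of_ne ?_)
      (by linarith)
    · rintro rfl
      refine hb (4 * i + 2) (by omega) ?_
      rw [combSide_of_even (by omega), combHeight_of_mod (by omega) (by omega) (by omega),
        combHeight_of_not_mod (by omega) (by omega) (by omega), Set.uIcc_of_ge (by norm_num),
        show (4 * i + 2) / 2 = 2 * i + 1 by omega]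
      exact ⟨by simp, hy1, hy2⟩
    · rintro rfl
      rcases eq_or_ne (i + 1) k with rfl | h
      · exact hright (by push_cast; ring) ⟨hy1, by linarith⟩
      refine hb (4 * i + 4) (by omega) ?_
      rw [combSide_of_even (by omega), combHeight_of_not_mod (by omega) (by omega) (by omega),
        combHeight_of_mod (by omega) (by omega) (by omega), Set.uIcc_of_le (by norm_num),
        show (4 * i + 4) / 2 = 2 * i + 2 by omega]
      exact ⟨by simp, hy1, hy2⟩
    · rintro rfl
      refine hb (4 * i + 3) (by omega) ?_
      rw [combSide_of_odd (by omega) (by omega),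
        combHeight_of_not_mod (by omega) (by omega) (by omega),
        show (4 * i + 3) / 2 = 2 * i + 1 by omega]
      push_cast
      exact ⟨⟨hx1, by linarith⟩, rfl⟩

theorem not_isBounded_singleton_prod {a : ℝ} {s : Set ℝ} (hs : ¬ Bornology.IsBounded s) :
    ¬ Bornology.IsBounded ({a} ×ˢ s) := fun h =>
  hs (by simpa [Set.snd_image_prod (Set.singleton_nonempty a)] using! h.image_snd)

theorem not_isBounded_prod_singleton {a : ℝ} {s : Set ℝ} (hs : ¬ Bornology.IsBounded s) :
    ¬ Bornology.IsBounded (s ×ˢ {a}) := fun h =>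
  hs (by simpa [Set.fst_image_prod _ (Set.singleton_nonempty a)] using! h.image_fst)

/-- An axis-parallel ray always escapes: left, right or up when the point is beyond the handle, and
otherwise straight down, since the point lies between teeth or below one. -/
theorem comb_escape {k : ℕ} {x : ℝ × ℝ} (hx : x ∉ comb k) :
    ∃ C : Set (ℝ × ℝ), IsPreconnected C ∧ x ∈ C ∧ C ⊆ (comb k)ᶜ ∧ ¬ Bornology.IsBounded C := by
  obtain ⟨x, y⟩ := x
  have hIci : ∀ a : ℝ, ¬ Bornology.IsBounded (Set.Ici a) := fun a h =>
    not_bddAbove_Ici a h.bddAbove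
  have hIic : ∀ a : ℝ, ¬ Bornology.IsBounded (Set.Iic a) := fun a h =>
    not_bddBelow_Iic a h.bddBelow
  have hsub : ∀ z ∈ comb k, 0 ≤ z.1 ∧ z.1 ≤ 2 * k ∧ z.2 ≤ 1 := by
    rintro ⟨u, v⟩ (⟨⟨h1, h2⟩, h3, h4⟩ | h)
    · exact ⟨h1, h2, h4⟩
    · obtain ⟨⟨i, hi⟩, ⟨h1, h2⟩, h3, h4⟩ := Set.mem_iUnion.1 h
      have hi' : (i : ℝ) + 1 ≤ k := by exact_mod_cast hi
      have hi0 : (0 : ℝ) ≤ i := Nat.cast_nonneg i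
      simp only at h1 h2 h3 h4 ⊢
      exact ⟨by linarith, by linarith, by linarith⟩
  rcases lt_or_ge x 0 with h1 | h1
  · refine ⟨Set.Iic x ×ˢ {y}, isPreconnected_Iic.prod isPreconnected_singleton, ⟨le_refl x, rfl⟩, ?_,
      not_isBounded_prod_singleton (hIic x)⟩
    intro z hz hzc
    exact absurd ((hsub z hzc).1.trans hz.1) (not_le.2 h1)
  rcases lt_or_ge (2 * (k : ℝ)) x with h2 | h2
  · refine ⟨Set.Ici x ×ˢ {y}, isPreconnected_Ici.prod isPreconnected_singleton, ⟨le_refl x, rfl⟩, ?_,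
      not_isBounded_prod_singleton (hIci x)⟩
    intro z hz hzc
    exact absurd (le_trans hz.1 (hsub z hzc).2.1) (not_le.2 h2)
  rcases lt_or_ge 1 y with h3 | h3
  · refine ⟨{x} ×ˢ Set.Ici y, isPreconnected_singleton.prod isPreconnected_Ici, ⟨rfl, le_refl y⟩, ?_,
      not_isBounded_singleton_prod (hIci y)⟩
    intro z hz hzc
    exact absurd (le_trans hz.2 (hsub z hzc).2.2) (not_le.2 h3)
  have h4 : y < 0 := not_le.1 fun h => hx (mem_comb_handle ⟨h1, h2⟩ ⟨h, h3⟩)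
  refine ⟨{x} ×ˢ Set.Iic y, isPreconnected_singleton.prod isPreconnected_Iic, ⟨rfl, le_refl y⟩, ?_,
      not_isBounded_singleton_prod (hIic y)⟩
  rintro ⟨x', y'⟩ ⟨hz1, hz2⟩ hzc
  obtain rfl : x' = x := hz1
  have hz2 : y' ≤ y := hz2
  rcases hzc with h | h
  · exact absurd (h.2.1.trans hz2) (not_le.2 h4)
  · obtain ⟨i, hi, h5, -⟩ := Set.mem_iUnion.1 h
    exact hx (Or.inr (Set.mem_iUnion.2 ⟨i, hi, le_trans h5 hz2, h4.le⟩))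

theorem combPolygon_domain {k : ℕ} (hk : 1 ≤ k) : (combPolygon k hk).domain = comb k :=
  (combPolygon k hk).domain_eq_of_escape (isCompact_comb k) (combPolygon_boundary_subset hk)
    (comb_diff_boundary_subset hk) fun _ => comb_escape

/-! ### Guard numbers of the combs -/

/-- The bottom of a tooth of a comb is visible only from the vertical strip of that tooth. -/
theorem RVisible.mem_strip {k i : ℕ} {y : ℝ × ℝ}
    (h : RVisible (comb k) (2 * (i : ℝ) + 3 / 2, -5) y) :
    2 * (i : ℝ) + 1 ≤ y.1 ∧ y.1 ≤ 2 * (i : ℝ) + 2 := by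
  obtain ⟨a, b, c, d, -, -, hR, ⟨hx, hc⟩, ⟨hy, -⟩⟩ := h
  simp only at hx hc hy
  have hmem : ∀ t ∈ Set.uIcc (2 * (i : ℝ) + 3 / 2) y.1, (t, -5) ∈ comb k := fun t ht =>
    hR ⟨Set.uIcc_subset_Icc hx hy ht, hc⟩
  constructor
  · by_contra hlt
    rw [not_le] at hlt
    -- The clamped abscissa lies in `[2i + 1/2, 2i + 1)`, just left of tooth `i`, where no tooth
    -- reaches height `-5`.
    have hm := hmem (max y.1 (2 * (i : ℝ) + 1 / 2)) (Set.mem_uIcc.2 (Or.inr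
      ⟨le_max_left _ _, max_le (by linarith) (by linarith)⟩))
    obtain ⟨j, -, h1, h2⟩ := mem_comb_of_neg hm (by norm_num)
    have h3 : 2 * (i : ℝ) + 1 / 2 ≤ 2 * j + 2 := (le_max_right _ _).trans h2
    have h4 : 2 * (j : ℝ) + 1 < 2 * i + 1 := h1.trans_lt (max_lt hlt (by linarith))
    have h5 : j < i := by exact_mod_cast (by linarith : (j : ℝ) < i)
    have h6 : (j : ℝ) + 1 ≤ i := by exact_mod_cast h5
    linarith
  · by_contra hlt
    rw [not_le] at hlt
    have hm := hmem (min y.1 (2 * (i : ℝ) + 5 / 2)) (Set.mem_uIcc.2 (Or.inl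
      ⟨le_min (by linarith) (by linarith), min_le_left _ _⟩))
    obtain ⟨j, -, h1, h2⟩ := mem_comb_of_neg hm (by norm_num)
    have h3 : 2 * (j : ℝ) + 1 ≤ 2 * i + 5 / 2 := h1.trans (min_le_right _ _)
    have h4 : 2 * (i : ℝ) + 2 < 2 * j + 2 := (lt_min hlt (by linarith)).trans_le h2
    have h5 : i < j := by exact_mod_cast (by linarith : (i : ℝ) < j)
    have h6 : (i : ℝ) + 1 ≤ j := by exact_mod_cast h5
    linarith

theorem nat_eq_of_mem_strip {i j : ℕ} {t : ℝ} (hi : 2 * (i : ℝ) + 1 ≤ t ∧ t ≤ 2 * (i : ℝ) + 2)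
    (hj : 2 * (j : ℝ) + 1 ≤ t ∧ t ≤ 2 * (j : ℝ) + 2) : i = j := by
  have h1 : (i : ℝ) < j + 1 := by linarith [hi.1, hj.2]
  have h2 : (j : ℝ) < i + 1 := by linarith [hj.1, hi.2]
  have h3 : i < j + 1 := by exact_mod_cast h1
  have h4 : j < i + 1 := by exact_mod_cast h2
  omega

theorem natCast_le_encard {α : Type*} {k : ℕ} {S : Set α} (f : Fin k → α)
    (hf : Function.Injective f) (hS : ∀ i, f i ∈ S) : (k : ℕ∞) ≤ S.encard := by
  have h := Set.encard_le_encard (Set.range_subset_iff.2 hS)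
  rwa [← Set.image_univ, hf.encard_image, Set.encard_univ, ENat.card_eq_coe_fintype_card,
    Fintype.card_fin] at h

theorem tooth_bottom_mem_comb {k : ℕ} (i : Fin k) : (2 * (i : ℝ) + 3 / 2, (-5 : ℝ)) ∈ comb k :=
  comb_tooth_subset i.2 ⟨⟨by simp only; linarith, by simp only; linarith⟩, by norm_num, by norm_num⟩

theorem le_minPoint_combPolygon {k : ℕ} (hk : 1 ≤ k) : (k : ℕ∞) ≤ (combPolygon k hk).minPoint := by
  refine le_iInf₂ fun S hS => ?_
  obtain ⟨-, hcov⟩ := hS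
  rw [combPolygon_domain] at hcov
  choose f hf hvis using fun i : Fin k => hcov _ (tooth_bottom_mem_comb i)
  refine natCast_le_encard f (fun i j hij => Fin.ext ?_) hf
  have h := (hvis j).mem_strip
  rw [← hij] at h
  exact nat_eq_of_mem_strip (hvis i).mem_strip h

theorem le_minVertical_combPolygon {k : ℕ} (hk : 1 ≤ k) :
    (k : ℕ∞) ≤ (combPolygon k hk).minVertical := by
  refine le_iInf₂ fun S hS => ?_
  obtain ⟨hg, hcov⟩ := hS
  rw [combPolygon_domain] at hcov
  choose f hf y hy hvis using fun i : Fin k => hcov _ (tooth_bottom_mem_comb i)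
  refine natCast_le_encard f (fun i j hij => Fin.ext ?_) hf
  obtain ⟨⟨a, c, d, -, hL⟩, -⟩ := hg _ (hf i)
  have hi := hy i
  have hj := hy j
  rw [← hij, hL] at hj
  rw [hL] at hi
  -- All points of one vertical guard share an abscissa, so it cannot serve two strips.
  have h : (y i).1 = (y j).1 := Eq.trans hi.1 (Eq.symm hj.1)
  have h' := (hvis j).mem_strip
  rw [← h] at h'
  exact nat_eq_of_mem_strip (hvis i).mem_strip h'

/-- Every point of a comb sees both a point of the middle line of the handle and a point of the
axis of some tooth. -/
theorem comb_visible {k : ℕ} (hk : 1 ≤ k) {z : ℝ × ℝ} (hz : z ∈ comb k) :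
    (∃ s ∈ Set.Icc 0 (2 * (k : ℝ)), RVisible (comb k) z (s, 1 / 2)) ∧
      ∃ i : Fin k, ∃ t ∈ Set.Icc (-5 : ℝ) 1, RVisible (comb k) z (2 * (i : ℝ) + 3 / 2, t) := by
  have hk' : (1 : ℝ) ≤ k := by exact_mod_cast hk
  rcases hz with hz | hz
  · have hR : Set.Icc 0 (2 * (k : ℝ)) ×ˢ Set.Icc 0 1 ⊆ comb k := Set.subset_union_left
    refine ⟨⟨0, ⟨le_rfl, by linarith⟩, 0, 2 * k, 0, 1, by linarith, zero_lt_one, hR, hz,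
      ⟨le_rfl, by linarith⟩, by norm_num, by norm_num⟩, ⟨0, hk⟩, 0, ⟨by norm_num, by norm_num⟩,
      0, 2 * k, 0, 1, by linarith, zero_lt_one, hR, hz, ⟨by norm_num, ?_⟩, le_rfl, zero_le_one⟩
    simp only [Nat.cast_zero]
    linarith
  · obtain ⟨i, ⟨hx1, hx2⟩, hy1, hy2⟩ := Set.mem_iUnion.1 hz
    have hi' : (i : ℝ) + 1 ≤ k := by exact_mod_cast i.2
    have hi0 : (0 : ℝ) ≤ i := Nat.cast_nonneg _
    have hR := comb_tooth_subset i.2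
    have hzR : z ∈ Set.Icc (2 * (i : ℝ) + 1) (2 * (i : ℝ) + 2) ×ˢ Set.Icc (-5) 1 :=
      ⟨⟨hx1, hx2⟩, hy1, hy2.trans zero_le_one⟩
    exact ⟨⟨2 * i + 1, ⟨by linarith, by linarith⟩, _, _, _, _, by linarith, by norm_num, hR, hzR,
      ⟨le_rfl, by simp only; linarith⟩, by norm_num, by norm_num⟩, i, 0, ⟨by norm_num, by norm_num⟩,
      _, _, _, _, by linarith, by norm_num, hR, hzR,
      ⟨by simp only; linarith, by simp only; linarith⟩, by norm_num, by norm_num⟩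

theorem minHorizontal_combPolygon_le {k : ℕ} (hk : 1 ≤ k) :
    (combPolygon k hk).minHorizontal ≤ 1 := by
  have hk' : (1 : ℝ) ≤ k := by exact_mod_cast hk
  refine (iInf₂_le {Set.Icc 0 (2 * (k : ℝ)) ×ˢ {1 / 2}} ⟨?_, ?_⟩).trans
    (Set.encard_singleton _).le
  · rintro _ rfl
    refine ⟨⟨_, _, _, by linarith, rfl⟩, ?_, ?_⟩
    · rw [combPolygon_domain]
      rintro ⟨x, y⟩ ⟨hx, hy⟩
      obtain rfl : y = 1 / 2 := hy
      exact mem_comb_handle hx ⟨by norm_num, by norm_num⟩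
    · rintro M ⟨⟨⟨a, b, c, -, rfl⟩, -⟩, -⟩ hLM
      obtain ⟨-, hc⟩ := hLM (show ((0 : ℝ), (1 / 2 : ℝ)) ∈ _ from ⟨⟨le_rfl, by linarith⟩, rfl⟩)
      obtain rfl : 1 / 2 = c := hc
      rw [Set.disjoint_right]
      rintro _ ⟨i, rfl⟩ ⟨-, h⟩
      -- Vertices have height 1, 0 or -5, never 1/2.
      have h : combHeight k (ZMod.val (n := 4 * k + 2) i) = 1 / 2 := h
      unfold combHeight at h
      split_ifs at h <;> norm_num at h
  · rw [combPolygon_domain]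
    intro z hz
    obtain ⟨s, hs, hv⟩ := (comb_visible hk hz).1
    exact ⟨_, rfl, (s, 1 / 2), ⟨hs, rfl⟩, hv⟩

theorem minVertical_combPolygon_le {k : ℕ} (hk : 1 ≤ k) :
    (combPolygon k hk).minVertical ≤ k := by
  have hcard := Set.encard_image_le
    (fun i : Fin k => ({2 * (i : ℝ) + 3 / 2} : Set ℝ) ×ˢ Set.Icc (-5 : ℝ) 1) Set.univ
  rw [Set.encard_univ, ENat.card_eq_coe_fintype_card, Fintype.card_fin] at hcard
  refine (iInf₂_le _ ⟨?_, ?_⟩).trans hcard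
  · rintro _ ⟨i, -, rfl⟩
    refine ⟨⟨_, _, _, by norm_num, rfl⟩, ?_, ?_⟩
    · rw [combPolygon_domain]
      rintro ⟨x, y⟩ ⟨hx, hy⟩
      obtain rfl : x = _ := hx
      exact comb_tooth_subset i.2 ⟨⟨by simp only; linarith, by simp only; linarith⟩, hy⟩
    · rintro M ⟨⟨⟨a, c, d, -, rfl⟩, -⟩, -⟩ hLM
      obtain ⟨ha, -⟩ := hLM (show (2 * (i : ℝ) + 3 / 2, (0 : ℝ)) ∈ _ from
        ⟨rfl, by norm_num, by norm_num⟩)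
      obtain rfl : _ = a := ha
      rw [Set.disjoint_right]
      rintro _ ⟨j, rfl⟩ ⟨h, -⟩
      have h : ((ZMod.val (n := 4 * k + 2) j / 2 : ℕ) : ℝ) = 2 * (i : ℝ) + 3 / 2 := h
      generalize ZMod.val (n := 4 * k + 2) j / 2 = m at h
      -- Vertex abscissae are integers and the axis is at a half-integer; after doubling, parity
      -- decides.
      have h2 : (2 * m : ℝ) = 4 * (i : ℕ) + 3 := by linarith
      have h3 : 2 * m = 4 * (i : ℕ) + 3 := by exact_mod_cast h2
      omega
  · rw [combPolygon_domain]
    intro z hz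
    obtain ⟨i, t, ht, hv⟩ := (comb_visible hk hz).2
    exact ⟨_, ⟨i, trivial, rfl⟩, (2 * (i : ℝ) + 3 / 2, t), ⟨rfl, ht⟩, hv⟩

theorem OrthogonalPolygon.one_le_minHorizontal (P : OrthogonalPolygon) : 1 ≤ P.minHorizontal := by
  refine le_iInf₂ fun S hS => ?_
  obtain ⟨z, hz⟩ := P.domain_nonempty
  obtain ⟨L, hL, -⟩ := hS.2 z hz
  exact Set.one_le_encard_iff_nonempty.2 ⟨L, hL⟩

theorem mainTheorem3 :
    (∀ P : OrthogonalPolygon, P.minVertical = 1 ∨ P.minHorizontal = 1 →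
      P.minPoint ≤ P.minVertical + P.minHorizontal - 1) ∧
    (∀ k : ℕ, 1 ≤ k →
      (∃ P : OrthogonalPolygon, P.domain = comb k ∧
        P.minHorizontal = 1 ∧ P.minVertical = k ∧ P.minPoint = k) ∧
      (∃ P : OrthogonalPolygon, P.domain = Prod.swap '' comb k ∧
        P.minVertical = 1 ∧ P.minHorizontal = k ∧ P.minPoint = k)) := by
  refine ⟨?_, fun k hk => ?_⟩
  · rintro P (h | h)
    -- Cancellation in `ℕ∞` only needs the subtracted 1 to be finite.
    · rw [h, add_comm, ENat.addLECancellable_of_ne_top ENat.one_ne_top |>.add_tsub_cancel_right]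
      exact P.minPoint_le_minHorizontal h
    · rw [h, ENat.addLECancellable_of_ne_top ENat.one_ne_top |>.add_tsub_cancel_right]
      exact P.minPoint_le_minVertical h
  · have hH : (combPolygon k hk).minHorizontal = 1 :=
      (minHorizontal_combPolygon_le hk).antisymm (combPolygon k hk).one_le_minHorizontal
    have hV : (combPolygon k hk).minVertical = k :=
      (minVertical_combPolygon_le hk).antisymm (le_minVertical_combPolygon hk)
    have hP : (combPolygon k hk).minPoint = k :=
      (((combPolygon k hk).minPoint_le_minVertical hH).trans hV.le).antisymm
        (le_minPoint_combPolygon hk)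
    refine ⟨⟨_, combPolygon_domain hk, hH, hV, hP⟩, (combPolygon k hk).swap, ?_, ?_, ?_, ?_⟩
    · rw [OrthogonalPolygon.domain_swap, combPolygon_domain, Set.image_swap_eq_preimage_swap]
    · rw [OrthogonalPolygon.minVertical_swap, hH]
    · rw [OrthogonalPolygon.minHorizontal_swap, hV]
    · rw [OrthogonalPolygon.minPoint_swap, hP]
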